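/- Let $k,n\ge 0$ be integers. For $\pi\in S_k$ let $\mu=(\mu_1,\dots,\mu_l)$ be the cycle-type of $\pi$ (fixed points counted as cycles of length $1$) and $\kappa(\pi)=l$ its number of cycles. For an $n\times n$ matrix $A$ put $\mathrm{Tr}_\pi(A)=\prod_{r=1}^{l}\mathrm{Tr}(A^{\mu_r})$, and for sequences $\mathbf i=(i_1,\dots,i_k)$, $\mathbf j=(j_1,\dots,j_k)$ in $\{1,\dots,n\}$ put $\delta_\pi(\mathbf i,\mathbf j)=\prod_{s=1}^k\delta_{i_{\pi(s)},j_s}$. Let $L(S_k)$ be the algebra of complex functions on $S_k$ with the convolution $(f*g)(\pi)=\sum_{\tau\in S_k}f(\tau)g(\tau^{-1}\pi)$. For $z\in\mathbb C$, the unitary Weingarten function $\mathrm{Wg}^U(\cdot;z)$ is the pseudo-inverse of $z^{\kappa(\cdot)}$ in the center of $L(S_k)$, i.e. the unique central element with $z^{\kappa(\cdot)}*\mathrm{Wg}^U(\cdot;z)*z^{\kappa(\cdot)}=z^{\kappa(\cdot)}$ and $\mathrm{Wg}^U(\cdot;z)*z^{\kappa(\cdot)}*\mathrm{Wg}^U(\cdot;z)=\mathrm{Wg}^U(\cdot;z)$.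 Theorem. Let $W=(w_{ij})$ be an $n\times n$ complex Hermitian random matrix such that $UWU^*$ has the same distribution as $W$ for every (deterministic) $n\times n$ unitary matrix $U$. Let $\mathbf i=(i_1,\dots,i_k)$ and $\mathbf j=(j_1,\dots,j_k)$ be sequences in $\{1,\dots,n\}$, and suppose that the expectations in the formula below exist, i.e. that $w_{i_1j_1}\cdots w_{i_kj_k}$ and $\mathrm{Tr}_\tau(W)$, for all $\tau\in S_k$, are integrable. Then $$E[w_{i_1j_1}w_{i_2j_2}\cdots w_{i_kj_k}]=\sum_{\sigma,\tau\in S_k}\delta_\sigma(\mathbf i,\mathbf j)\,\mathrm{Wg}^U(\sigma^{-1}\tau;n)\,E[\mathrm{Tr}_\tau(W)].$$ -/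

import Mathlib

open MeasureTheory ProbabilityTheory
open scoped Matrix

/-- The number `κ(π)` of cycles of `π`, fixed points included: the length of its cycle-type.
(`Equiv.Perm.partition` is the cycle-type with the fixed points counted as parts `1`.) -/
def numCycles {k : ℕ} (π : Equiv.Perm (Fin k)) : ℕ :=
  Multiset.card π.partition.parts

/-- `Tr_π(A) = ∏_j Tr(A ^ μ_j)`, where `μ` is the cycle-type of `π`. -/
noncomputable def trPerm {n k : ℕ} (π : Equiv.Perm (Fin k)) (A : Matrix (Fin n) (Fin n) ℂ) : ℂ :=
  (π.partition.parts.map fun m => (A ^ m).trace).prod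

/-- `δ_π(i, j) = ∏_s δ_{i_{π(s)}, j_s}`. -/
def deltaPerm {n k : ℕ} (π : Equiv.Perm (Fin k)) (i j : Fin k → Fin n) : ℂ :=
  ∏ s, if i (π s) = j s then 1 else 0

/-- The function `π ↦ z ^ κ(π)` on `S_k`, as an element of the algebra of complex functions on `S_k`
with the convolution `(f * g)(π) = ∑ τ, f τ * g (τ⁻¹ * π)`, that is, of the group algebra. -/
noncomputable def cyclePow (k : ℕ) (z : ℂ) : MonoidAlgebra ℂ (Equiv.Perm (Fin k)) :=
  ∑ π : Equiv.Perm (Fin k), MonoidAlgebra.single π (z ^ numCycles π)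

/-- `b` is a pseudo-inverse of `a` in the center of the ring `R`. -/
structure IsCentralPseudoInverse {R : Type*} [Ring R] (a b : R) : Prop where
  mem_center : b ∈ Subring.center R
  mul_mul_left : a * b * a = a
  mul_mul_right : b * a * b = b

/-- A central element of a semisimple ring has exactly one pseudo-inverse in the center. -/
theorem existsUnique_isCentralPseudoInverse {R : Type*} [Ring R] [IsSemisimpleRing R] {a : R}
    (ha : a ∈ Subring.center R) : ∃! b, IsCentralPseudoInverse a b := by
  have hc : ∀ r, r * a = a * r := Subring.mem_center_iff.1 ha
  obtain ⟨f, hf, hI⟩ := IsSemisimpleRing.ideal_eq_span_idempotent (Ideal.span {a})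
  have h1 : a ∈ Ideal.span {f} := hI ▸ Ideal.mem_span_singleton_self a
  have h2 : f ∈ Ideal.span {a} := hI ▸ Ideal.mem_span_singleton_self f
  obtain ⟨u, hu⟩ := Ideal.mem_span_singleton'.1 h1
  obtain ⟨y, hy⟩ := Ideal.mem_span_singleton'.1 h2
  have haf : a * f = a := by rw [← hu, mul_assoc, hf.eq]
  have hay : a * (a * y) = a := by rw [← hc y, hy, haf]
  have hay' : a * y * a = a := by rw [hc, hay]
  have hya : ∀ r, a * y * (a * r) = a * r := fun r => by
    rw [← mul_assoc, hay']
  have hra : ∀ r, r * a * (a * y) = r * a := fun r => by rw [mul_assoc, hay]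
  -- `a * y` is a central idempotent
  have he : ∀ r, r * (a * y) = a * y * r := fun r => by
    have e1 : a * y * (r * (a * y)) = r * (a * y) := by
      rw [← mul_assoc r, hc r, mul_assoc a r y, hya]
    have e2 : a * y * r * (a * y) = a * y * r := by
      have : a * y * r = y * r * a := by rw [hc (y * r), mul_assoc]
      rw [this, hra]
    rw [← e1, ← mul_assoc (a * y) r, e2]
  have hidem : a * y * (a * y) = a * y := hya y
  have hab : a * (a * y * y) = a * y := by
    rw [← mul_assoc, hay]
  have hbc : ∀ r, r * (a * y * y) = a * y * y * r := fun r => by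
    have hba : (a * y * y) * a = a * y := by rw [hc, hab]
    have hbe : (a * y * y) * (a * y) = a * y * y := by
      rw [he, ← mul_assoc, hidem]
    calc r * (a * y * y) = (r * (a * y)) * (a * y * y) := by
            rw [mul_assoc r, ← mul_assoc (a * y) (a * y), hidem]
      _ = (a * y) * r * (a * y * y) := by rw [he r]
      _ = (a * y * y) * a * r * (a * y * y) := by rw [hba]
      _ = (a * y * y) * r * (a * (a * y * y)) := by
            rw [mul_assoc (a * y * y) a r, ← hc r]; simp only [mul_assoc]
      _ = (a * y * y) * (r * (a * y)) := by rw [hab, mul_assoc]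
      _ = (a * y * y) * r := by rw [he r, ← mul_assoc, hbe]
  refine ⟨a * y * y, ⟨Subring.mem_center_iff.2 hbc, ?_, ?_⟩, ?_⟩
  · rw [hab, hay']
  · rw [hc, hab, ← mul_assoc, hidem]
  · rintro c ⟨hcc, hc1, hc2⟩
    have hcc' : ∀ r, r * c = c * r := Subring.mem_center_iff.1 hcc
    -- both `a * c` and `a * y` are identities of the ideal `R a`
    have h3 : a * c = a * y := by
      have e1 : a * c * (a * y) = a * y := by rw [← mul_assoc, hc1]
      have e2 : a * y * (a * c) = a * c := hya c
      rw [← e2, ← he, e1]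
    calc c = c * (a * c) := by rw [← mul_assoc, hc2]
      _ = c * (a * y) := by rw [h3]
      _ = (a * c) * y := by rw [← mul_assoc, hc]
      _ = a * y * y := by rw [h3]

theorem cyclePow_mem_center (k : ℕ) (z : ℂ) :
    cyclePow k z ∈ Subring.center (MonoidAlgebra ℂ (Equiv.Perm (Fin k))) := by
  have hconj : ∀ g π : Equiv.Perm (Fin k), numCycles (g * π * g⁻¹) = numCycles π := fun g π => by
    have h : IsConj π (g * π * g⁻¹) := isConj_iff.2 ⟨g, rfl⟩
    rw [Equiv.Perm.partition_eq_of_isConj] at h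
    rw [numCycles, numCycles, h]
  rw [Subring.mem_center_iff]
  intro f
  induction f using MonoidAlgebra.induction_linear with
  | zero => simp
  | add f g hf hg => rw [add_mul, mul_add, hf, hg]
  | single g c =>
    simp only [cyclePow, Finset.mul_sum, Finset.sum_mul, MonoidAlgebra.single_mul_single]
    refine Fintype.sum_equiv (MulAut.conj g).toEquiv _ _ fun π => ?_
    simp [hconj, mul_comm]

theorem existsUnique_weingarten (k : ℕ) (z : ℂ) :
    ∃! b, IsCentralPseudoInverse (cyclePow k z) b :=
  haveI : NeZero (Nat.card (Equiv.Perm (Fin k)) : ℂ) := ⟨Nat.cast_ne_zero.2 Nat.card_pos.ne'⟩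
  existsUnique_isCentralPseudoInverse (cyclePow_mem_center k z)

/-- The unitary Weingarten function: the unique pseudo-inverse of `z ^ κ(·)` in the center of the
convolution algebra of complex functions on `S_k`. -/
noncomputable def unitaryWg {k : ℕ} (π : Equiv.Perm (Fin k)) (z : ℂ) : ℂ :=
  (existsUnique_weingarten k z).choose.coeff π

/-- The product (Borel) σ-algebra on complex matrices. -/
noncomputable instance instMeasurableSpaceComplexMatrix (n : ℕ) :
    MeasurableSpace (Matrix (Fin n) (Fin n) ℂ) :=
  inferInstanceAs (MeasurableSpace (Fin n → Fin n → ℂ))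

/-! Let `V` be the space of matrices `C` on `(ℂⁿ)^{⊗k}` with `tr(C W^{⊗k})` integrable, and `L C`
the expectation of this trace. Invariance of the law of `W` makes `L` invariant under conjugation by
`U^{⊗k}`. Represent `L` as the Frobenius pairing with some `X ∈ V`; invariance forces `X` to commute
with every `U^{⊗k}`, so by Schur–Weyl duality `X` is a combination of permutation matrices. Hence
`L` vanishes on every element of `V` orthogonal to all permutations. Working inside `V` means that
only the assumed expectations are needed, with no averaging over Haar measure.

The Gram matrix of the permutations is convolution by `n ^ κ`, so its pseudo-inverse `Wg` yields the
orthogonal projection of a matrix unit onto their span (`sum_permMatrix_mul_unitaryWg_mul`). `L`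
takes the same value on the matrix unit and on its projection, and `tr(P_τ W^{⊗k}) = Tr_τ(W)` gives
the formula. -/

/-! ### Contractions of a matrix along a permutation. -/

section CycleTrace

variable {ι R : Type*} [Fintype ι] [CommSemiring R]

/-- The sum `∑ a, ∏ s, A (a s) (a (σ s))`, that is, the trace of the action of `σ` composed with a
tensor power of `A`. -/
def permContraction {α : Type*} [Fintype α] [DecidableEq α] (A : Matrix ι ι R)
    (σ : Equiv.Perm α) : R :=
  ∑ a : α → ι, ∏ s, A (a s) (a (σ s))

theorem permContraction_permCongr {α β : Type*} [Fintype α] [DecidableEq α] [Fintype β]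
    [DecidableEq β] (A : Matrix ι ι R) (e : α ≃ β) (σ : Equiv.Perm α) :
    permContraction A (e.permCongr σ) = permContraction A σ := by
  refine Fintype.sum_equiv (e.arrowCongr (Equiv.refl ι)).symm _ _ fun a => ?_
  refine (Fintype.prod_equiv e _ _ fun s => ?_).symm
  simp [Equiv.permCongr_apply]

theorem permContraction_sumCongr {α β : Type*} [Fintype α] [DecidableEq α] [Fintype β]
    [DecidableEq β] (A : Matrix ι ι R) (σ : Equiv.Perm α) (τ : Equiv.Perm β) :
    permContraction A (σ.sumCongr τ) = permContraction A σ * permContraction A τ := by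
  rw [permContraction, permContraction, permContraction, Finset.sum_mul_sum,
    ← Fintype.sum_prod_type']
  refine Fintype.sum_equiv (Equiv.sumArrowEquivProdArrow α β ι) _ _ fun a => ?_
  simp [Fintype.prod_sum_type]

variable [DecidableEq ι]

/-- Sum over walks from `p` to `q`: `a` lists the `m` intermediate vertices, so `cons p a` gives the
sources and `snoc a q` the targets of the steps. -/
theorem Matrix.pow_succ_apply_eq_sum_prod (A : Matrix ι ι R) (m : ℕ) (p q : ι) :
    (A ^ (m + 1)) p q = ∑ a : Fin m → ι,
      ∏ s, A (Fin.cons (α := fun _ => ι) p a s) (Fin.snoc (α := fun _ => ι) a q s) := by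
  induction m generalizing p with
  | zero => simp [Fin.snoc]
  | succ m ih =>
    rw [pow_succ', Matrix.mul_apply, ← (Fin.consEquiv fun _ => ι).sum_comp, Fintype.sum_prod_type]
    refine Finset.sum_congr rfl fun x _ => ?_
    rw [ih, Finset.mul_sum]
    refine Finset.sum_congr rfl fun a _ => ?_
    symm
    calc _ = ∏ s, A (Fin.cons (α := fun _ => ι) p (Fin.cons (α := fun _ => ι) x a) s)
          (Fin.cons (α := fun _ => ι) x (Fin.snoc (α := fun _ => ι) a q) s) := by
          rw [Fin.cons_snoc_eq_snoc_cons (β := ι) x a q]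
          rfl
      _ = _ := by
          rw [Fin.prod_univ_succ]
          simp only [Fin.cons_zero, Fin.cons_succ]

theorem permContraction_finRotate (A : Matrix ι ι R) (m : ℕ) :
    permContraction A (finRotate (m + 1)) = (A ^ (m + 1)).trace := by
  rw [permContraction, Matrix.trace, ← (Fin.consEquiv fun _ => ι).sum_comp, Fintype.sum_prod_type]
  refine Finset.sum_congr rfl fun p _ => ?_
  rw [Matrix.diag_apply, Matrix.pow_succ_apply_eq_sum_prod]
  refine Finset.sum_congr rfl fun a _ => Finset.prod_congr rfl fun s _ => ?_
  rw [Fin.snoc_eq_cons_rotate]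
  rfl

end CycleTrace

/-! ### Cycle types of transported permutations, disjoint sums and full cycles. -/

section Partition

open Equiv.Perm

theorem Equiv.Perm.partition_parts_permCongr {α β : Type*} [Fintype α] [DecidableEq α] [Fintype β]
    [DecidableEq β] (e : α ≃ β) (σ : Equiv.Perm α) :
    (e.permCongr σ).partition.parts = σ.partition.parts := by
  have h : (e.permCongr σ).cycleType = σ.cycleType := by
    rw [← cycleType_extendDomain (e.trans (Equiv.subtypeUnivEquiv fun _ : β => trivial).symm)
      (g := σ)]
    congr 1
  rw [parts_partition, parts_partition, h, ← sum_cycleType, ← sum_cycleType, h,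
    Fintype.card_congr e]

theorem Equiv.Perm.cycleType_sumCongr {α β : Type*} [Fintype α] [DecidableEq α] [Fintype β]
    [DecidableEq β] (σ : Equiv.Perm α) (τ : Equiv.Perm β) :
    (σ.sumCongr τ).cycleType = σ.cycleType + τ.cycleType := by
  have h1 : σ.sumCongr (1 : Equiv.Perm β)
      = σ.extendDomain (Equiv.ofInjective (Sum.inl : α → α ⊕ β) Sum.inl_injective) := by
    ext x
    rcases x with a | b
    · exact (σ.extendDomain_apply_image
        (Equiv.ofInjective (Sum.inl : α → α ⊕ β) Sum.inl_injective) a).symm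
    · rw [extendDomain_apply_not_subtype _ _ (by simp)]
      rfl
  have h2 : (1 : Equiv.Perm α).sumCongr τ
      = τ.extendDomain (Equiv.ofInjective (Sum.inr : β → α ⊕ β) Sum.inr_injective) := by
    ext x
    rcases x with a | b
    · rw [extendDomain_apply_not_subtype _ _ (by simp)]
      rfl
    · exact (τ.extendDomain_apply_image
        (Equiv.ofInjective (Sum.inr : β → α ⊕ β) Sum.inr_injective) b).symm
  have h : σ.sumCongr τ = σ.sumCongr (1 : Equiv.Perm β) * (1 : Equiv.Perm α).sumCongr τ := by
    rw [sumCongr_mul, one_mul, mul_one]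
  have hd : Disjoint (σ.sumCongr (1 : Equiv.Perm β)) ((1 : Equiv.Perm α).sumCongr τ) := by
    rintro (a | b) <;> simp
  rw [h, hd.cycleType_mul, h1, h2, cycleType_extendDomain, cycleType_extendDomain]

theorem Equiv.Perm.partition_parts_sumCongr {α β : Type*} [Fintype α] [DecidableEq α] [Fintype β]
    [DecidableEq β] (σ : Equiv.Perm α) (τ : Equiv.Perm β) :
    (σ.sumCongr τ).partition.parts = σ.partition.parts + τ.partition.parts := by
  simp only [parts_partition, ← sum_cycleType, cycleType_sumCongr, Fintype.card_sum,
    Multiset.sum_add]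
  -- Supports fit in their types, so the truncated subtractions counting fixed points add up.
  have h1 := sum_cycleType σ ▸ Finset.card_le_univ σ.support
  have h2 := sum_cycleType τ ▸ Finset.card_le_univ τ.support
  rw [show Fintype.card α + Fintype.card β - (σ.cycleType.sum + τ.cycleType.sum) =
    (Fintype.card α - σ.cycleType.sum) + (Fintype.card β - τ.cycleType.sum) by
      omega, Multiset.replicate_add]
  abel

theorem Equiv.Perm.partition_parts_finRotate (m : ℕ) :
    (finRotate (m + 1)).partition.parts = {m + 1} := by
  -- On one point the rotation is the identity: its part `1` is a fixed point, absent from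
  -- `cycleType`.
  rcases m with _ | m
  · rw [parts_partition, (show finRotate (0 + 1) = 1 from Equiv.ext fun _ => Subsingleton.elim (α := Fin 1) _ _)]
    simp
  · rw [parts_partition, cycleType_finRotate, support_finRotate]
    simp

end Partition

/-- One model permutation per cycle type, a disjoint sum of rotations; conjugation invariance then
carries the trace formula to all permutations. -/
theorem exists_perm_partition_permContraction (l : List ℕ) (hl : ∀ m ∈ l, 0 < m) :
    ∃ σ : Equiv.Perm (Fin l.sum), σ.partition.parts = l ∧
      ∀ (n : ℕ) (A : Matrix (Fin n) (Fin n) ℂ),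
        permContraction A σ = (l.map fun m => (A ^ m).trace).prod := by
  induction l with
  | nil =>
    refine ⟨1, ?_, fun n A => ?_⟩
    · rw [Equiv.Perm.parts_partition]
      simp only [List.sum_nil]
      rfl
    · have : IsEmpty (Fin ([] : List ℕ).sum) := by rw [List.sum_nil]; infer_instance
      rw [permContraction, Fintype.sum_unique, Fintype.prod_empty]
      rfl
  | cons m l ih =>
    obtain ⟨σ, hσ, h⟩ := ih fun x hx => hl x (List.mem_cons_of_mem _ hx)
    obtain ⟨m, rfl⟩ := Nat.exists_eq_succ_of_ne_zero (hl m List.mem_cons_self).ne'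
    refine ⟨(finSumFinEquiv.trans (finCongr List.sum_cons.symm)).permCongr
      ((finRotate (m + 1)).sumCongr σ), ?_, fun n A => ?_⟩
    · rw [Equiv.Perm.partition_parts_permCongr, Equiv.Perm.partition_parts_sumCongr, hσ,
        Equiv.Perm.partition_parts_finRotate]
      rfl
    · rw [permContraction_permCongr, permContraction_sumCongr, permContraction_finRotate, h,
        List.map_cons, List.prod_cons]

/-- `∑ a, ∏ s, A (a s) (a (σ s)) = Tr_σ(A)`. -/
theorem permContraction_eq_trPerm {n k : ℕ} (σ : Equiv.Perm (Fin k))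
    (A : Matrix (Fin n) (Fin n) ℂ) : permContraction A σ = trPerm σ A := by
  set l := σ.partition.parts.toList with hl
  have hl' : (l : Multiset ℕ) = σ.partition.parts := Multiset.coe_toList _
  obtain ⟨τ, hτ, h⟩ := exists_perm_partition_permContraction l fun m hm =>
    σ.partition.parts_pos (Multiset.mem_toList.1 hm)
  have hk : l.sum = k := by
    rw [← Multiset.sum_coe, hl', σ.partition.parts_sum, Fintype.card_fin]
  have hp : ((finCongr hk).permCongr τ).partition = σ.partition := by
    rw [Nat.Partition.ext_iff, Equiv.Perm.partition_parts_permCongr, hτ, hl']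
  obtain ⟨c, hc⟩ := isConj_iff.1 (Equiv.Perm.partition_eq_of_isConj.2 hp)
  have h1 : permContraction A σ = permContraction A ((finCongr hk).permCongr τ) := by
    rw [← permContraction_permCongr A c ((finCongr hk).permCongr τ), ← hc]
    rfl
  rw [h1, permContraction_permCongr, h, trPerm, ← hl', Multiset.map_coe, Multiset.prod_coe]

/-! ### Tensor powers of matrices. -/

section KroneckerPower

variable {ι R : Type*} [CommSemiring R]

/-- The matrix of the `k`-th tensor power of `A`, with rows and columns indexed by sequences. -/
def Matrix.tensorPow (k : ℕ) (A : Matrix ι ι R) : Matrix (Fin k → ι) (Fin k → ι) R :=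
  Matrix.of fun a b => ∏ s, A (a s) (b s)

theorem Matrix.tensorPow_apply (k : ℕ) (A : Matrix ι ι R) (a b : Fin k → ι) :
    A.tensorPow k a b = ∏ s, A (a s) (b s) := rfl

theorem Matrix.tensorPow_mul [Fintype ι] (k : ℕ) (A B : Matrix ι ι R) :
    (A * B).tensorPow k = A.tensorPow k * B.tensorPow k := by
  classical
  ext a b
  simp only [tensorPow_apply, Matrix.mul_apply, Finset.prod_univ_sum, Fintype.piFinset_univ,
    Finset.prod_mul_distrib]

theorem Matrix.tensorPow_one [DecidableEq ι] (k : ℕ) :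
    (1 : Matrix ι ι R).tensorPow k = 1 := by
  ext a b
  rw [tensorPow_apply]
  by_cases h : a = b
  · subst h
    rw [Matrix.one_apply_eq]
    exact Finset.prod_eq_one fun s _ => Matrix.one_apply_eq _
  · obtain ⟨s, hs⟩ := Function.ne_iff.1 h
    rw [Matrix.one_apply_ne h]
    exact Finset.prod_eq_zero (Finset.mem_univ s) (Matrix.one_apply_ne hs)

theorem Matrix.tensorPow_conjTranspose [StarRing R] (k : ℕ) (A : Matrix ι ι R) :
    Aᴴ.tensorPow k = (A.tensorPow k)ᴴ := by
  ext a b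
  simp [tensorPow_apply, Matrix.conjTranspose_apply, star_prod]

end KroneckerPower

/-! ### Zariski density of the unitary group. -/

section ZariskiDensity

variable {ι : Type*} [Fintype ι] [DecidableEq ι]

theorem Complex.infinite_unit_circle : {z : ℂ | ‖z‖ = 1}.Infinite := by
  have h : IsPreconnected (Metric.sphere (0 : ℂ) 1) :=
    isPreconnected_sphere (by rw [Complex.rank_real_complex]; exact Cardinal.one_lt_two) 0 1
  have : (Metric.sphere (0 : ℂ) 1).Infinite := h.infinite_of_nontrivial
    ⟨1, by simp, -1, by simp, by norm_num⟩
  simpa [Metric.sphere] using this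

/-- For fixed `V` this is a polynomial in `d` that vanishes on the torus `|d l| = 1`, a product of
infinite sets, hence identically. -/
theorem MvPolynomial.aeval_conj_diagonal_eq_zero (P : MvPolynomial (ι × ι) ℂ)
    (h : ∀ U ∈ Matrix.unitaryGroup ι ℂ, aeval (fun x => U x.1 x.2) P = 0)
    {V : Matrix ι ι ℂ} (hV : V ∈ Matrix.unitaryGroup ι ℂ) (d : ι → ℂ) :
    aeval (fun x => (V * Matrix.diagonal d * Vᴴ) x.1 x.2) P = 0 := by
  let Q : MvPolynomial ι ℂ :=
    bind₁ (fun x : ι × ι => ∑ l, C (V x.1 l * star (V x.2 l)) * X l) P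
  have hQ : ∀ d : ι → ℂ, aeval d Q = aeval (fun x => (V * Matrix.diagonal d * Vᴴ) x.1 x.2) P := by
    intro d
    rw [aeval_bind₁]
    congr 2
    ext x
    rw [Matrix.mul_apply]
    simp [Matrix.mul_diagonal, Matrix.conjTranspose_apply, mul_right_comm]
  have hQ0 : Q = 0 := by
    refine funext_set (fun _ => {z : ℂ | ‖z‖ = 1}) (fun _ => Complex.infinite_unit_circle)
      fun d hd => ?_
    have hd' : ∀ l, ‖d l‖ = 1 := fun l => hd l (Set.mem_univ l)
    rw [map_zero, ← coe_aeval_eq_eval, RingHom.coe_coe, hQ]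
    refine h _ (mul_mem (mul_mem hV ?_) (Unitary.star_mem hV))
    rw [Matrix.mem_unitaryGroup_iff, Matrix.star_eq_conjTranspose, Matrix.diagonal_conjTranspose,
      Matrix.diagonal_mul_diagonal, ← Matrix.diagonal_one]
    congr 1
    ext l
    simp [Complex.mul_conj, Complex.normSq_eq_norm_sq, hd' l]
  rw [← hQ, hQ0, map_zero]

/-- The unitary group is Zariski dense in the space of complex matrices. -/
theorem MvPolynomial.eq_zero_of_aeval_unitaryGroup (P : MvPolynomial (ι × ι) ℂ)
    (h : ∀ U ∈ Matrix.unitaryGroup ι ℂ, aeval (fun x => U x.1 x.2) P = 0) : P = 0 := by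
  have hherm : ∀ H : Matrix ι ι ℂ, H.IsHermitian → aeval (fun x => H x.1 x.2) P = 0 := by
    intro H hH
    have := aeval_conj_diagonal_eq_zero P h hH.eigenvectorUnitary.2
      (RCLike.ofReal ∘ hH.eigenvalues)
    have hs := hH.spectral_theorem
    rw [Unitary.conjStarAlgAut_apply] at hs
    rw [hs]
    exact this
  refine funext fun y => ?_
  let A : Matrix ι ι ℂ := Matrix.of fun p q => y (p, q)
  let B : Matrix ι ι ℂ := (realPart A : Matrix ι ι ℂ)
  let D : Matrix ι ι ℂ := (imaginaryPart A : Matrix ι ι ℂ)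
  have hA : A = B + Complex.I • D := (realPart_add_I_smul_imaginaryPart A).symm
  -- Restrict `P` to the line `B + t D`: the matrix is Hermitian for real `t`, so `Q` has infinitely
  -- many roots, and `t = I` recovers `A`.
  let Q : Polynomial ℂ :=
    aeval (fun x : ι × ι => Polynomial.C (B x.1 x.2) + Polynomial.X * Polynomial.C (D x.1 x.2)) P
  have hQ : ∀ t : ℂ, Polynomial.aeval t Q = aeval (fun x => (B + t • D) x.1 x.2) P := by
    intro t
    change Polynomial.aeval t (aeval _ P) = _
    rw [MvPolynomial.comp_aeval_apply]
    congr 2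
    ext x
    simp [mul_comm t]
  have hQ0 : Q = 0 := by
    refine Polynomial.eq_zero_of_infinite_isRoot _
      ((Set.infinite_range_of_injective Complex.ofReal_injective).mono ?_)
    rintro _ ⟨t, rfl⟩
    change Polynomial.eval _ _ = 0
    rw [← Polynomial.coe_aeval_eq_eval, hQ]
    refine hherm _ ?_
    have h1 : B.IsHermitian := (realPart A).2
    have h2 : D.IsHermitian := (imaginaryPart A).2
    refine h1.add ?_
    rw [Matrix.IsHermitian, Matrix.conjTranspose_smul, h2.eq]
    simp
  have := hQ Complex.I
  rw [hQ0, map_zero, ← hA] at this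
  rw [map_zero, ← coe_aeval_eq_eval, RingHom.coe_coe]
  exact this.symm

end ZariskiDensity

/-! ### Double commutant theorem for finite groups. -/

section DoubleCommutant

/-- By Maschke the module is semisimple, so Jacobson density applies: `f` is linear over the
commutant, hence agrees with a group algebra element on a finite basis. -/
theorem Representation.exists_asAlgebraHom_eq_of_commute {K G V : Type*} [Field K] [Group G]
    [Finite G] [NeZero (Nat.card G : K)] [AddCommGroup V] [Module K V] [FiniteDimensional K V]
    (ρ : Representation K G V) (f : V →ₗ[K] V)
    (hf : ∀ g : V →ₗ[K] V, (∀ σ v, g (ρ σ v) = ρ σ (g v)) → ∀ v, f (g v) = g (f v)) :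
    ∃ r, ρ.asAlgebraHom r = f := by
  classical
  let R := MonoidAlgebra K G
  let e := ρ.asModuleEquiv
  have hcomm : ∀ (g : Module.End R ρ.asModule) (v : ρ.asModule),
      f (e (g v)) = e (g (e.symm (f (e v)))) := by
    intro g v
    let g' : V →ₗ[K] V :=
      e.toLinearMap ∘ₗ (g.restrictScalars K) ∘ₗ e.symm.toLinearMap
    have := hf g' (fun σ w => ?_) (e v)
    · simpa [g'] using this
    · change e (g (e.symm (ρ σ w))) = ρ σ (e (g (e.symm w)))
      rw [Representation.asModuleEquiv_symm_map_rho, map_smul,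
        Representation.asModuleEquiv_map_smul]
      simp [e]
  let F : Module.End (Module.End R ρ.asModule) ρ.asModule :=
    { toFun := fun v => e.symm (f (e v))
      map_add' := fun v w => by simp
      map_smul' := fun g v => by
        apply e.injective
        simpa using hcomm g v }
  let b := Module.finBasis K V
  obtain ⟨r, hr⟩ := jacobson_density F (Finset.univ.image fun l => e.symm (b l))
  refine ⟨r, b.ext fun l => ?_⟩
  have := hr (e.symm (b l)) (Finset.mem_image_of_mem _ (Finset.mem_univ l))
  have h2 := congrArg e this
  rw [Representation.asModuleEquiv_map_smul] at h2
  simpa [F, e] using h2.symm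

end DoubleCommutant

/-! ### Schur–Weyl duality for the unitary group. -/

section SchurWeyl

theorem exists_perm_comp_eq_of_sum_single_eq {X : Type*} {k : ℕ} {x y : Fin k → X}
    (h : ∑ s, Finsupp.single (x s) 1 = ∑ s, Finsupp.single (y s) 1) :
    ∃ σ : Equiv.Perm (Fin k), ∀ s, y (σ s) = x s := by
  classical
  have hc : ∀ c, Nonempty ({s // x s = c} ≃ {s // y s = c}) := fun c => by
    have := DFunLike.congr_fun h c
    simp only [Finsupp.finsetSum_apply, Finsupp.single_apply, Finset.sum_boole] at this
    rw [← Fintype.card_eq, Fintype.card_subtype, Fintype.card_subtype]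
    exact_mod_cast this
  exact ⟨Equiv.ofFiberEquiv fun c => (hc c).some, Equiv.ofFiberEquiv_map _⟩

variable {ι : Type*} [DecidableEq ι] {k : ℕ}

/-- The action of the symmetric group on the `k`-th tensor power of `ℂ ^ ι`. -/
def tensorPermRep (ι : Type*) (k : ℕ) :
    Representation ℂ (Equiv.Perm (Fin k)) ((Fin k → ι) → ℂ) where
  toFun σ := LinearMap.funLeft ℂ ℂ fun a => a ∘ σ
  map_one' := rfl
  map_mul' _ _ := rfl

/-- The matrix of the action of a permutation on the `k`-th tensor power. -/
def permMatrix (ι : Type*) [DecidableEq ι] {k : ℕ} (σ : Equiv.Perm (Fin k)) :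
    Matrix (Fin k → ι) (Fin k → ι) ℂ :=
  Matrix.of fun a b => ∏ s, if b (σ s) = a s then 1 else 0

theorem permMatrix_apply (σ : Equiv.Perm (Fin k)) (a b : Fin k → ι) :
    permMatrix ι σ a b = if b ∘ σ = a then 1 else 0 := by
  rw [permMatrix, Matrix.of_apply, Finset.prod_ite_zero]
  simp [funext_iff]

variable [Fintype ι]

/-- A matrix commuting with all tensor powers of unitary matrices commutes with every matrix
invariant under simultaneous permutations of the tensor factors. -/
theorem Matrix.commute_of_commute_tensorPow {C : Matrix (Fin k → ι) (Fin k → ι) ℂ}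
    (hC : ∀ U ∈ Matrix.unitaryGroup ι ℂ, Commute C (U.tensorPow k))
    {B : Matrix (Fin k → ι) (Fin k → ι) ℂ}
    (hB : ∀ (σ : Equiv.Perm (Fin k)) a b, B (a ∘ σ) (b ∘ σ) = B a b) : Commute C B := by
  classical
  -- `m a b` is the exponent of the monomial `∏ x_{a_s b_s}`, the `(a, b)` entry of a generic tensor
  -- power. It determines `(a, b)` up to simultaneous permutation, so `B` factors through it and
  -- defines a functional `φ` on polynomials.
  let m : (Fin k → ι) → (Fin k → ι) → (ι × ι →₀ ℕ) := fun a b =>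
    ∑ s, Finsupp.single (a s, b s) 1
  let β : (ι × ι →₀ ℕ) → ℂ := fun x =>
    if h : ∃ p : (Fin k → ι) × (Fin k → ι), m p.1 p.2 = x then B h.choose.1 h.choose.2 else 0
  have hβ : ∀ a b, β (m a b) = B a b := by
    intro a b
    have h : ∃ p : (Fin k → ι) × (Fin k → ι), m p.1 p.2 = m a b := ⟨(a, b), rfl⟩
    obtain ⟨σ, hσ⟩ := exists_perm_comp_eq_of_sum_single_eq h.choose_spec
    simp only [β, dif_pos h]
    rw [← hB σ a b]
    congr 1
    · exact funext fun s => (congrArg Prod.fst (hσ s)).symm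
    · exact funext fun s => (congrArg Prod.snd (hσ s)).symm
  let φ : MvPolynomial (ι × ι) ℂ →ₗ[ℂ] ℂ := (MvPolynomial.basisMonomials _ ℂ).constr ℂ β
  have hφ : ∀ a b, φ (MvPolynomial.monomial (m a b) 1) = B a b := by
    intro a b
    rw [← hβ, ← (MvPolynomial.basisMonomials _ ℂ).constr_basis ℂ β (m a b),
      MvPolynomial.coe_basisMonomials]
  have hev : ∀ (A : Matrix ι ι ℂ) a b,
      MvPolynomial.aeval (fun x => A x.1 x.2) (MvPolynomial.monomial (m a b) (1 : ℂ))
        = A.tensorPow k a b := by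
    intro A a b
    rw [MvPolynomial.aeval_monomial, map_one, one_mul, tensorPow_apply,
      ← Finsupp.prod_finsetSum_index (by simp) (by simp [pow_add])]
    simp
  ext a b
  -- The `(a, b)` entry of the commutator of `C` with a generic tensor power. It is zero by Zariski
  -- density, and `φ` turns it into the same entry for `B`.
  let P : MvPolynomial (ι × ι) ℂ := ∑ e, C a e • MvPolynomial.monomial (m e b) 1
    - ∑ e, C e b • MvPolynomial.monomial (m a e) 1
  have hP : P = 0 := by
    refine MvPolynomial.eq_zero_of_aeval_unitaryGroup P fun U hU => ?_
    have := congrFun (congrFun (hC U hU).eq a) b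
    simp only [Matrix.mul_apply] at this
    simp only [P, map_sub, map_sum, map_smul, hev, smul_eq_mul]
    rw [this, sub_eq_zero]
    exact Finset.sum_congr rfl fun e _ => mul_comm _ _
  have h0 := congrArg φ hP
  simp only [P, map_sub, map_sum, map_smul, hφ, smul_eq_mul, map_zero] at h0
  rw [Matrix.mul_apply, Matrix.mul_apply, sub_eq_zero.1 h0]
  exact Finset.sum_congr rfl fun e _ => mul_comm _ _

/-- The commutant of the tensor powers of unitary matrices is spanned by the permutations. -/
theorem Matrix.mem_span_permMatrix_of_commute_tensorPow {C : Matrix (Fin k → ι) (Fin k → ι) ℂ}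
    (hC : ∀ U ∈ Matrix.unitaryGroup ι ℂ, Commute C (U.tensorPow k)) :
    C ∈ Submodule.span ℂ (Set.range (permMatrix ι (k := k))) := by
  have : NeZero (Nat.card (Equiv.Perm (Fin k)) : ℂ) := ⟨Nat.cast_ne_zero.2 Nat.card_pos.ne'⟩
  have hperm : ∀ σ : Equiv.Perm (Fin k),
      tensorPermRep ι k σ = Matrix.toLin' (permMatrix ι σ⁻¹) := by
    intro σ
    refine LinearMap.ext fun f => funext fun a => ?_
    have h : ∀ b : Fin k → ι, b ∘ ⇑σ⁻¹ = a ↔ b = a ∘ σ := fun b =>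
      σ.comp_symm_eq a b
    simp only [Matrix.toLin'_apply, Matrix.mulVec, dotProduct, permMatrix_apply, h, ite_mul,
      one_mul, zero_mul, Finset.sum_ite_eq', Finset.mem_univ, if_true]
    rfl
  obtain ⟨r, hr⟩ : ∃ r, (tensorPermRep ι k).asAlgebraHom r = Matrix.toLin' C := by
    refine (tensorPermRep ι k).exists_asAlgebraHom_eq_of_commute _ fun g hg v => ?_
    -- Commuting with the permutation action means that the matrix of `g` is invariant under
    -- simultaneous permutation of its indices.
    have hB : ∀ (σ : Equiv.Perm (Fin k)) a b,
        LinearMap.toMatrix' g (a ∘ σ) (b ∘ σ) = LinearMap.toMatrix' g a b := by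
      intro σ a b
      have := congrFun (hg σ (Pi.single (b ∘ σ) 1)) a
      have hs : tensorPermRep ι k σ (Pi.single (b ∘ σ) 1) = Pi.single b 1 := by
        funext c
        change (Pi.single (b ∘ σ) 1 : (Fin k → ι) → ℂ) (c ∘ σ) = _
        simp only [Pi.single_apply, σ.surjective.injective_comp_right.eq_iff]
      rw [hs] at this
      simp only [LinearMap.toMatrix'_apply, this]
      rfl
    have := (Matrix.commute_of_commute_tensorPow hC hB).eq
    have h2 := congrArg (fun M => Matrix.toLin' M v) this
    simpa [Matrix.toLin'_mul] using h2
  have : C = ∑ σ, r.coeff σ • permMatrix ι σ⁻¹ := by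
    apply Matrix.toLin'.injective
    rw [← hr, map_sum, Representation.asAlgebraHom_def, MonoidAlgebra.lift_apply]
    simp only [map_smul, ← hperm]
    exact Finsupp.sum_fintype _ _ (by simp)
  rw [this]
  exact Submodule.sum_mem _ fun σ _ =>
    Submodule.smul_mem _ _ (Submodule.subset_span ⟨σ⁻¹, rfl⟩)

end SchurWeyl

/-! ### Functionals invariant under unitary conjugation. -/

section InvariantFunctional

open scoped ComplexOrder

/-- A linear functional on a space of matrices is the trace pairing with an element of the space. -/
theorem Matrix.exists_forall_eq_trace_conjTranspose_mul {I : Type*} [Fintype I]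
    (V : Submodule ℂ (Matrix I I ℂ)) (L : V →ₗ[ℂ] ℂ) :
    ∃ X : V, ∀ C : V, L C = ((X : Matrix I I ℂ)ᴴ * (C : Matrix I I ℂ)).trace := by
  let e : EuclideanSpace ℂ (I × I) ≃ₗ[ℂ] Matrix I I ℂ :=
    (WithLp.linearEquiv 2 ℂ (I × I → ℂ)).trans (LinearEquiv.curry ℂ ℂ I I)
  let V' : Submodule ℂ (EuclideanSpace ℂ (I × I)) := V.comap e.toLinearMap
  let f : V' →ₗ[ℂ] V := e.toLinearMap.restrict fun _ h => h
  let L' : StrongDual ℂ V' := LinearMap.toContinuousLinearMap (L ∘ₗ f)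
  let x : V' := (InnerProductSpace.toDual ℂ V').symm L'
  refine ⟨f x, fun C => ?_⟩
  let c : V' := ⟨e.symm C, by simp [V']⟩
  have hc : f c = C := Subtype.ext (e.apply_symm_apply _)
  have h : inner ℂ x c = L' c := InnerProductSpace.toDual_symm_apply
  change _ = L (f c) at h
  rw [← hc, ← h, Submodule.coe_inner, PiLp.inner_apply, Fintype.sum_prod_type_right]
  simp only [Matrix.trace, Matrix.diag_apply, Matrix.mul_apply, Matrix.conjTranspose_apply]
  refine Finset.sum_congr rfl fun b _ => Finset.sum_congr rfl fun a _ => ?_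
  rw [RCLike.inner_apply, mul_comm]
  rfl

variable {ι : Type*} [Fintype ι] [DecidableEq ι] {k : ℕ}

/-- A linear functional invariant under conjugation by tensor powers of unitary matrices vanishes
on the matrices orthogonal to the permutations. -/
theorem Matrix.eq_zero_of_forall_trace_permMatrix_eq_zero
    (V : Submodule ℂ (Matrix (Fin k → ι) (Fin k → ι) ℂ)) (L : V →ₗ[ℂ] ℂ)
    (hL : ∀ U ∈ Matrix.unitaryGroup ι ℂ, ∀ C : V,
      ∃ h : (U.tensorPow k)ᴴ * (C : Matrix _ _ ℂ) * U.tensorPow k ∈ V, L ⟨_, h⟩ = L C)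
    (x : V) (hx : ∀ σ : Equiv.Perm (Fin k),
      ((permMatrix ι σ)ᴴ * (x : Matrix (Fin k → ι) (Fin k → ι) ℂ)).trace = 0) : L x = 0 := by
  obtain ⟨⟨X, hX⟩, h⟩ := Matrix.exists_forall_eq_trace_conjTranspose_mul V L
  simp only at h
  have hcomm : ∀ U ∈ Matrix.unitaryGroup ι ℂ, Commute X (U.tensorPow k) := by
    intro U hU
    set T := U.tensorPow k with hT
    have hTT : Tᴴ * T = 1 := by
      rw [hT, ← Matrix.tensorPow_conjTranspose, ← Matrix.tensorPow_mul,
        ← Matrix.star_eq_conjTranspose, Matrix.mem_unitaryGroup_iff'.1 hU, Matrix.tensorPow_one]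
    -- Membership lets `X - T X Tᴴ` be tested against itself in `horth`, which forces it to vanish.
    have hV : T * X * Tᴴ ∈ V := by
      obtain ⟨h1, -⟩ := hL _ (Unitary.star_mem hU) ⟨X, hX⟩
      rwa [Matrix.star_eq_conjTranspose, Matrix.tensorPow_conjTranspose,
        Matrix.conjTranspose_conjTranspose] at h1
    have horth : ∀ C ∈ V, ((X - T * X * Tᴴ)ᴴ * C).trace = 0 := by
      intro C hC
      obtain ⟨h1, h2⟩ := hL U hU ⟨C, hC⟩
      rw [h, h] at h2
      simp only at h2
      rw [Matrix.conjTranspose_sub, Matrix.sub_mul, Matrix.trace_sub, ← h2, sub_eq_zero]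
      simp only [Matrix.conjTranspose_mul, Matrix.conjTranspose_conjTranspose]
      rw [← Matrix.mul_assoc, Matrix.trace_mul_comm]
      simp only [Matrix.mul_assoc, T]
    have h0 := Matrix.trace_conjTranspose_mul_self_eq_zero_iff.1 (horth _ (V.sub_mem hX hV))
    rw [sub_eq_zero] at h0
    calc X * T = T * X * Tᴴ * T := by rw [← h0]
      _ = T * X := by rw [Matrix.mul_assoc, hTT, Matrix.mul_one]
  have hspan := Matrix.mem_span_permMatrix_of_commute_tensorPow hcomm
  rw [h]
  clear h hcomm hX
  induction hspan using Submodule.span_induction with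
  | mem y hy =>
    obtain ⟨σ, rfl⟩ := hy
    exact hx σ
  | zero => simp
  | add y z _ _ hy hz => rw [Matrix.conjTranspose_add, Matrix.add_mul, Matrix.trace_add, hy, hz,
      add_zero]
  | smul c y _ hy => rw [Matrix.conjTranspose_smul, Matrix.smul_mul, Matrix.trace_smul, hy,
      smul_zero]

end InvariantFunctional

/-! ### The Gram matrix of the permutations and its pseudo-inverse. -/

section Gram

open scoped ComplexOrder

theorem numCycles_eq_of_cycleType_eq {k : ℕ} {σ τ : Equiv.Perm (Fin k)}
    (h : σ.cycleType = τ.cycleType) : numCycles σ = numCycles τ := by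
  rw [numCycles, numCycles, Equiv.Perm.partition_eq_of_isConj.1
    (Equiv.Perm.isConj_iff_cycleType_eq.2 h)]

theorem trPerm_one {n k : ℕ} (σ : Equiv.Perm (Fin k)) :
    trPerm σ (1 : Matrix (Fin n) (Fin n) ℂ) = (n : ℂ) ^ numCycles σ := by
  simp [trPerm, numCycles]

theorem trace_permMatrix_mul_tensorPow {n k : ℕ} (σ : Equiv.Perm (Fin k))
    (A : Matrix (Fin n) (Fin n) ℂ) :
    (permMatrix (Fin n) σ * A.tensorPow k).trace = trPerm σ A := by
  rw [← permContraction_eq_trPerm, Matrix.trace_mul_comm]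
  simp only [Matrix.trace, Matrix.diag_apply, Matrix.mul_apply, permMatrix_apply, mul_ite, mul_one,
    mul_zero, Finset.sum_ite_eq, Finset.mem_univ, if_true, Matrix.tensorPow_apply]
  rfl

/-- The order reverses because permutations act by precomposition: `a = b ∘ σ` and `b = c ∘ τ` give
`a = c ∘ (τ * σ)`. -/
theorem permMatrix_mul {ι : Type*} [Fintype ι] [DecidableEq ι] {k : ℕ}
    (σ τ : Equiv.Perm (Fin k)) :
    permMatrix ι σ * permMatrix ι τ = permMatrix ι (τ * σ) := by
  ext a c
  simp only [Matrix.mul_apply, permMatrix_apply, mul_ite, mul_one, mul_zero, Finset.sum_ite_eq,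
    Finset.mem_univ, if_true]
  rfl

theorem permMatrix_conjTranspose {ι : Type*} [DecidableEq ι] {k : ℕ} (σ : Equiv.Perm (Fin k)) :
    (permMatrix ι σ)ᴴ = permMatrix ι σ⁻¹ := by
  ext a b
  rw [Matrix.conjTranspose_apply, permMatrix_apply, permMatrix_apply]
  have h : a ∘ ⇑σ = b ↔ b ∘ ⇑σ⁻¹ = a := by
    rw [eq_comm]
    exact (σ.comp_symm_eq a b).symm
  simp only [h]
  split_ifs <;> simp

theorem trace_conjTranspose_permMatrix_mul_permMatrix {n k : ℕ} (ρ τ : Equiv.Perm (Fin k)) :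
    ((permMatrix (Fin n) ρ)ᴴ * permMatrix (Fin n) τ).trace = (n : ℂ) ^ numCycles (ρ⁻¹ * τ) := by
  have h : numCycles (τ * ρ⁻¹) = numCycles (ρ⁻¹ * τ) := by
    apply numCycles_eq_of_cycleType_eq
    rw [← Equiv.Perm.cycleType_conj (σ := ρ⁻¹ * τ) (τ := τ)]
    congr 1
    group
  rw [permMatrix_conjTranspose, permMatrix_mul, ← h, ← trPerm_one,
    ← trace_permMatrix_mul_tensorPow, Matrix.tensorPow_one, Matrix.mul_one]

/-- The matrix of convolution by an element of a group algebra. -/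
def convMatrix {G : Type*} [Group G] (f : MonoidAlgebra ℂ G) : Matrix G G ℂ :=
  Matrix.of fun σ τ => f.coeff (σ⁻¹ * τ)

theorem convMatrix_mul {G : Type*} [Group G] [Fintype G] (f g : MonoidAlgebra ℂ G) :
    convMatrix (f * g) = convMatrix f * convMatrix g := by
  classical
  ext σ ρ
  simp only [convMatrix, Matrix.of_apply, Matrix.mul_apply, MonoidAlgebra.coeff_mul]
  rw [Finsupp.sum_fintype _ _ (by simp), ← Equiv.sum_comp (Equiv.mulLeft σ⁻¹)]
  refine Finset.sum_congr rfl fun τ _ => ?_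
  rw [Finsupp.sum_fintype _ _ (by simp), Finset.sum_eq_single (τ⁻¹ * ρ)]
  · simp
  · intro y _ hy
    rw [if_neg]
    rintro h
    apply hy
    simp only [Equiv.coe_mulLeft, mul_assoc] at h
    rw [← mul_left_cancel h, inv_mul_cancel_left]
  · simp

theorem convMatrix_cyclePow_apply {k : ℕ} (z : ℂ) (σ τ : Equiv.Perm (Fin k)) :
    convMatrix (cyclePow k z) σ τ = z ^ numCycles (σ⁻¹ * τ) := by
  rw [convMatrix, Matrix.of_apply, cyclePow, MonoidAlgebra.coeff_sum, Finsupp.finsetSum_apply]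
  simp [Finsupp.single_apply]

/-- The Weingarten function inverts the Gram matrix of the permutations on its range. -/
theorem sum_permMatrix_mul_unitaryWg_mul {n k : ℕ} (a b : Fin k → Fin n)
    (ρ : Equiv.Perm (Fin k)) :
    ∑ σ : Equiv.Perm (Fin k), ∑ τ : Equiv.Perm (Fin k), permMatrix (Fin n) σ a b *
      unitaryWg (σ⁻¹ * τ) (n : ℂ) * (n : ℂ) ^ numCycles (τ⁻¹ * ρ) = permMatrix (Fin n) ρ a b := by
  let w := (existsUnique_weingarten k (n : ℂ)).choose
  have hw : IsCentralPseudoInverse (cyclePow k (n : ℂ)) w :=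
    (existsUnique_weingarten k (n : ℂ)).choose_spec.1
  -- The columns of `T` are the vectorised permutation matrices, so `Tᴴ * T` is their Gram matrix
  -- `G`. From `G (w G - 1) = 0` and `ker Tᴴ T = ker T` follows `T (w G - 1) = 0`, even when `G` is
  -- singular.
  let T : Matrix ((Fin k → Fin n) × (Fin k → Fin n)) (Equiv.Perm (Fin k)) ℂ :=
    Matrix.of fun p σ => permMatrix (Fin n) σ p.1 p.2
  have hT : Tᴴ * T = convMatrix (cyclePow k (n : ℂ)) := by
    ext σ τ
    rw [convMatrix_cyclePow_apply, ← trace_conjTranspose_permMatrix_mul_permMatrix]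
    simp only [Matrix.mul_apply, Matrix.trace, Matrix.diag_apply, Matrix.conjTranspose_apply,
      Fintype.sum_prod_type_right, T, Matrix.of_apply]
  have hG : Tᴴ * T * (convMatrix w * convMatrix (cyclePow k (n : ℂ)) - 1) = 0 := by
    rw [hT, Matrix.mul_sub, ← Matrix.mul_assoc, ← convMatrix_mul, ← convMatrix_mul,
      hw.mul_mul_left, Matrix.mul_one, sub_self]
  have hTE : T * (convMatrix w * convMatrix (cyclePow k (n : ℂ)) - 1) = 0 := by
    rw [← Matrix.conjTranspose_mul_self_eq_zero, Matrix.conjTranspose_mul, Matrix.mul_assoc,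
      ← Matrix.mul_assoc Tᴴ, hG, Matrix.mul_zero]
  rw [Matrix.mul_sub, Matrix.mul_one, sub_eq_zero] at hTE
  have h := congrFun (congrFun hTE (a, b)) ρ
  simp only [Matrix.mul_apply, Finset.mul_sum, convMatrix_cyclePow_apply, ← mul_assoc] at h
  exact h

end Gram

/-! ### The integration formula. -/

theorem measurable_trace_mul_tensorPow {n k : ℕ}
    (C : Matrix (Fin k → Fin n) (Fin k → Fin n) ℂ) :
    Measurable fun A : Matrix (Fin n) (Fin n) ℂ => (C * A.tensorPow k).trace := by
  have h : ∀ p q, Measurable fun A : Matrix (Fin n) (Fin n) ℂ => A p q := fun p q =>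
    (measurable_pi_apply q).comp (measurable_pi_apply p)
  simp only [Matrix.trace, Matrix.diag_apply, Matrix.mul_apply, Matrix.tensorPow_apply]
  exact Finset.measurable_fun_sum _ fun a _ => Finset.measurable_fun_sum _ fun b _ =>
    (Finset.measurable_fun_prod _ fun s _ => h _ _).const_mul _

theorem mainTheorem7 {Ω : Type*} [MeasurableSpace Ω] (μ : Measure Ω) [IsProbabilityMeasure μ]
    (n k : ℕ) (W : Ω → Matrix (Fin n) (Fin n) ℂ) (hW : AEMeasurable W μ)
    (hherm : ∀ᵐ ω ∂μ, (W ω).IsHermitian)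
    (hinv : ∀ U ∈ Matrix.unitaryGroup (Fin n) ℂ,
      IdentDistrib (fun ω => U * W ω * Uᴴ) W μ μ)
    (i j : Fin k → Fin n)
    (hlocal : Integrable (fun ω => ∏ s, W ω (i s) (j s)) μ)
    (hglobal : ∀ τ : Equiv.Perm (Fin k), Integrable (fun ω => trPerm τ (W ω)) μ) :
    ∫ ω, ∏ s, W ω (i s) (j s) ∂μ =
      ∑ σ : Equiv.Perm (Fin k), ∑ τ : Equiv.Perm (Fin k),
        deltaPerm σ i j * unitaryWg (σ⁻¹ * τ) (n : ℂ) * ∫ ω, trPerm τ (W ω) ∂μ := by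
  let p : Matrix (Fin k → Fin n) (Fin k → Fin n) ℂ → Ω → ℂ := fun C ω =>
    (C * (W ω).tensorPow k).trace
  have hadd : ∀ C D, p (C + D) = p C + p D := fun C D => funext fun ω => by
    simp only [p, Matrix.add_mul, Matrix.trace_add, Pi.add_apply]
  have hsmul : ∀ (c : ℂ) C, p (c • C) = c • p C := fun c C => funext fun ω => by
    simp only [p, Matrix.smul_mul, Matrix.trace_smul, Pi.smul_apply]
  let V : Submodule ℂ (Matrix (Fin k → Fin n) (Fin k → Fin n) ℂ) :=
    { carrier := {C | Integrable (p C) μ}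
      zero_mem' := by simp [p]
      add_mem' := fun {C D} hC hD => by
        rw [Set.mem_ofPred_eq, hadd]
        exact Integrable.add hC hD
      smul_mem' := fun c C hC => by
        rw [Set.mem_ofPred_eq, hsmul]
        exact Integrable.smul c hC }
  let L : V →ₗ[ℂ] ℂ :=
    { toFun := fun C => ∫ ω, p C ω ∂μ
      map_add' := fun C D => by
        rw [Submodule.coe_add, hadd]
        exact integral_add C.2 D.2
      map_smul' := fun c C => by
        rw [Submodule.coe_smul, hsmul]
        exact integral_smul c _ }
  have hperm : ∀ τ, p (permMatrix (Fin n) τ) = fun ω => trPerm τ (W ω) := fun τ =>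
    funext fun ω => trace_permMatrix_mul_tensorPow τ (W ω)
  have hpermV : ∀ τ, permMatrix (Fin n) τ ∈ V := fun τ => by
    change Integrable _ _
    rw [hperm]
    exact hglobal τ
  -- The indices are swapped because the trace against the matrix unit at `(j, i)` reads off the
  -- entry at `(i, j)`.
  have hsingle : p (Matrix.single j i 1) = fun ω => ∏ s, W ω (i s) (j s) :=
    funext fun ω => by
      simp only [p, Matrix.trace_mul_comm (Matrix.single j i (1 : ℂ)), Matrix.trace_mul_single]
      simp [Matrix.tensorPow_apply]
  have hsingleV : Matrix.single j i 1 ∈ V := by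
    change Integrable _ _
    rw [hsingle]
    exact hlocal
  -- The orthogonal projection of the matrix unit onto the span of the permutations.
  let y : V := ∑ σ : Equiv.Perm (Fin k), ∑ τ : Equiv.Perm (Fin k),
    (deltaPerm σ i j * unitaryWg (σ⁻¹ * τ) (n : ℂ)) • ⟨permMatrix (Fin n) τ, hpermV τ⟩
  have hzero : L (⟨Matrix.single j i 1, hsingleV⟩ - y) = 0 := by
    refine Matrix.eq_zero_of_forall_trace_permMatrix_eq_zero V L (fun U hU C => ?_) _ fun ρ => ?_
    · have hd := (hinv U hU).comp (measurable_trace_mul_tensorPow C.1)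
      have he : p ((U.tensorPow k)ᴴ * (C : Matrix _ _ ℂ) * U.tensorPow k) =
          (fun A => ((C : Matrix _ _ ℂ) * A.tensorPow k).trace) ∘ fun ω => U * W ω * Uᴴ := by
        funext ω
        simp only [p, Function.comp_apply, Matrix.tensorPow_mul, Matrix.tensorPow_conjTranspose]
        rw [Matrix.mul_assoc, Matrix.mul_assoc, Matrix.trace_mul_comm]
        simp only [Matrix.mul_assoc]
      refine ⟨?_, ?_⟩
      · change Integrable _ _
        rw [he, hd.integrable_iff]
        exact C.2
      · change ∫ ω, p _ ω ∂μ = _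
        rw [he]
        exact hd.integral_eq
    · have hy : (y : Matrix (Fin k → Fin n) (Fin k → Fin n) ℂ) =
          ∑ σ : Equiv.Perm (Fin k), ∑ τ : Equiv.Perm (Fin k),
            (deltaPerm σ i j * unitaryWg (σ⁻¹ * τ) (n : ℂ)) • permMatrix (Fin n) τ := by
        simp [y]
      have hsymm : ∀ τ : Equiv.Perm (Fin k), numCycles (ρ⁻¹ * τ) = numCycles (τ⁻¹ * ρ) :=
        fun τ => numCycles_eq_of_cycleType_eq <| by
          rw [← Equiv.Perm.cycleType_inv, mul_inv_rev, inv_inv]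
      rw [Submodule.coe_sub, hy, Matrix.mul_sub, Matrix.trace_sub, Matrix.trace_mul_single,
        sub_eq_zero]
      simp only [Matrix.mul_sum, Matrix.trace_sum, Matrix.mul_smul, Matrix.trace_smul,
        trace_conjTranspose_permMatrix_mul_permMatrix, hsymm, smul_eq_mul]
      -- `deltaPerm σ i j` unfolds to the `(j, i)` entry of `permMatrix σ`.
      have hρ := sum_permMatrix_mul_unitaryWg_mul j i ρ
      refine Eq.trans ?_ hρ.symm
      rw [Matrix.conjTranspose_apply, permMatrix_apply]
      split_ifs <;> simp
  rw [map_sub, sub_eq_zero] at hzero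
  simp only [y, map_sum, map_smul, smul_eq_mul] at hzero
  change ∫ ω, p _ ω ∂μ = ∑ σ, ∑ τ, _ * ∫ ω, p _ ω ∂μ at hzero
  simp only [hperm, hsingle] at hzero
  exact hzero
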